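/- Let $\mathcal H$ be a separable, nontrivial complex Hilbert space. For a measurable space $(\Omega,\Sigma)$, an observable on $\Sigma$ is a normalized positive operator valued measure $\mathsf A:\Sigma\to\mathcal L(\mathcal H)$: each $\mathsf A(X)$ is a positive operator, $\mathsf A(\Omega)=I$, and $\mathsf A$ is weakly $\sigma$-additive. Let $\mathcal O(\Sigma,\mathcal H)$ be the convex set of these observables. An observable $\mathsf A\in\mathcal O(\Sigma,\mathcal H)$ is called extreme if it is an extreme point of $\mathcal O(\Sigma,\mathcal H)$. It is called discrete if there is a finite or countably infinite set $\Xi\subseteq\Omega$ such that $\mathsf A(X)=0$ for every $X\in\Sigma$ with $\sum_{x\in\Xi}\delta_x(X)=0$, where $\delta_x$ is the Dirac measure at $x$. Let $(\Omega,\Sigma)$ and $(\Omega',\Sigma')$ be arbitrary measurable spaces, let $\mathsf A\in\mathcal O(\Sigma,\mathcal H)$ be discrete and extreme, and let $\mathsf B\in\mathcal O(\Sigma',\mathcal H)$ be arbitrary. Then $\mathsf A$ and $\mathsf B$ are coexistent if and only if they are jointly measurable. Here $\mathsf A$ and $\mathsf B$ are coexistent if there are a measurable space $(\overline\Omega,\overline\Sigma)$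 and an observable $\mathsf M\in\mathcal O(\overline\Sigma,\mathcal H)$ such that $$\{\mathsf A(X): X\in\Sigma\}\cup\{\mathsf B(Y): Y\in\Sigma'\}\subseteq\{\mathsf M(Z): Z\in\overline\Sigma\},$$ and they are jointly measurable if there is an observable $\mathsf N\in\mathcal O(\Sigma\otimes\Sigma',\mathcal H)$ on the product $\sigma$-algebra such that $\mathsf N(X\times\Omega')=\mathsf A(X)$ for all $X\in\Sigma$ and $\mathsf N(\Omega\times Y)=\mathsf B(Y)$ for all $Y\in\Sigma'$. -/

import Mathlib

open MeasureTheory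

universe u v w x

namespace QuantumObservable

/-- `IsObservable A` says that `A` is a quantum observable (a normalized positive operator valued
measure) on the σ-algebra of `Ω`, with values in the bounded operators on the Hilbert space `H`:
every `A X` is a positive operator, `A Ω` is the identity, and `A` is weakly σ-additive.

Only the values of `A` on measurable sets carry information. As for Mathlib's vector measures, a map
defined on the σ-algebra is represented by the function on all subsets that vanishes off the
σ-algebra, so that equality of observables is equality of functions. -/
structure IsObservable {Ω : Type u} [MeasurableSpace Ω] {H : Type v} [NormedAddCommGroup H]
    [InnerProductSpace ℂ H] [CompleteSpace H] (A : Set Ω → H →L[ℂ] H) : Prop where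
  /-- Representation convention: the value off the σ-algebra is `0`. -/
  not_measurable : ∀ X : Set Ω, ¬ MeasurableSet X → A X = 0
  /-- Positivity. -/
  isPositive : ∀ X : Set Ω, MeasurableSet X → (A X).IsPositive
  /-- Normalization. -/
  univ : A Set.univ = 1
  /-- Weak σ-additivity. -/
  hasSum_iUnion : ∀ X : ℕ → Set Ω, (∀ i, MeasurableSet (X i)) →
    (∀ i j, i ≠ j → Disjoint (X i) (X j)) → ∀ φ ψ : H,
      HasSum (fun i => inner ℂ φ (A (X i) ψ)) (inner ℂ φ (A (⋃ i, X i) ψ))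

/-- The set of all observables on the σ-algebra of `Ω` with values in the bounded operators on `H`,
inside the real vector space of all operator valued set functions. -/
def observables (Ω : Type u) [MeasurableSpace Ω] (H : Type v) [NormedAddCommGroup H]
    [InnerProductSpace ℂ H] [CompleteSpace H] : Set (Set Ω → H →L[ℂ] H) :=
  {A | IsObservable A}

/-- The observable `A` is extreme: it is an extreme point of the convex set of observables. -/
def IsExtreme {Ω : Type u} [MeasurableSpace Ω] {H : Type v} [NormedAddCommGroup H]
    [InnerProductSpace ℂ H] [CompleteSpace H] (A : Set Ω → H →L[ℂ] H) : Prop :=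
  A ∈ Set.extremePoints ℝ (observables Ω H)

/-- Absolute continuity of an operator valued set function with respect to a measure. -/
def AbsCont {Ω : Type u} [MeasurableSpace Ω] {H : Type v} [NormedAddCommGroup H]
    [InnerProductSpace ℂ H] (A : Set Ω → H →L[ℂ] H) (μ : Measure Ω) : Prop :=
  ∀ X : Set Ω, MeasurableSet X → μ X = 0 → A X = 0

/-- `A` is discrete: it is absolutely continuous with respect to a sum of Dirac measures at the
points of some finite or countably infinite set `Ξ`. -/
def IsDiscrete {Ω : Type u} [MeasurableSpace Ω] {H : Type v} [NormedAddCommGroup H]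
    [InnerProductSpace ℂ H] (A : Set Ω → H →L[ℂ] H) : Prop :=
  ∃ Ξ : Set Ω, Ξ.Countable ∧ AbsCont A (Measure.sum fun x : Ξ => Measure.dirac (x : Ω))

/-- The range of an operator valued set function on the σ-algebra of `Ω`. -/
def ran {Ω : Type u} [MeasurableSpace Ω] {H : Type v} [NormedAddCommGroup H]
    [InnerProductSpace ℂ H] (A : Set Ω → H →L[ℂ] H) : Set (H →L[ℂ] H) :=
  {T | ∃ X : Set Ω, MeasurableSet X ∧ A X = T}

/-- `A` and `B` are jointly measurable: there is an observable on the product σ-algebra whose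
marginals are `A` and `B`. -/
def JointlyMeasurable {Ω : Type u} [MeasurableSpace Ω] {Ω' : Type w} [MeasurableSpace Ω']
    {H : Type v} [NormedAddCommGroup H] [InnerProductSpace ℂ H] [CompleteSpace H]
    (A : Set Ω → H →L[ℂ] H) (B : Set Ω' → H →L[ℂ] H) : Prop :=
  ∃ N : Set (Ω × Ω') → H →L[ℂ] H, IsObservable N ∧
    (∀ X : Set Ω, MeasurableSet X → N (X ×ˢ Set.univ) = A X) ∧
    (∀ Y : Set Ω', MeasurableSet Y → N (Set.univ ×ˢ Y) = B Y)

/-- `A` and `B` are coexistent: there is an observable `M`, on some σ-algebra over some set `Θ`,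
whose range contains the ranges of `A` and `B`. The universe `x` of `Θ` is a parameter. -/
def Coexistent {Ω : Type u} [MeasurableSpace Ω] {Ω' : Type w} [MeasurableSpace Ω']
    {H : Type v} [NormedAddCommGroup H] [InnerProductSpace ℂ H] [CompleteSpace H]
    (A : Set Ω → H →L[ℂ] H) (B : Set Ω' → H →L[ℂ] H) : Prop :=
  ∃ (Θ : Type x) (_ : MeasurableSpace Θ) (M : Set Θ → H →L[ℂ] H),
    IsObservable M ∧ ran A ∪ ran B ⊆ ran M

end QuantumObservable

/-! Suppose the range of `M` contains the ranges of `A` and `B`. Extremality of `A` is used twice,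
each time through a σ-additive perturbation `D` of total value zero with `A ± D` positive
(`IsExtreme.eq_zero`). Shifting mass between two atoms shows that sets representing different atoms
overlap in an `M`-null set (`IsAtomFamily.eq_zero_of_le`). They can therefore be made disjoint, and
`A` becomes the image of `M` under `x ∘ f`, with `f` measurable into a countable index set
(`IsAtomFamily.exists_index`). Taking for `D` an additivity defect shows that, although the sets `W
Y` with `M (W Y) = B Y` are chosen arbitrarily, `Y ↦ M (f ⁻¹' {i} ∩ W Y)` is additive on each fibre
(`IsExtreme.preimage_inter_add`). Being dominated by `B`, it is σ-additive
(`IsObservable.tsum_quad_of_le`). Gluing over the countably many fibres gives the joint observable.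
Conversely, a joint observable already has both ranges inside its own. -/

namespace QuantumObservable

/-! ### Quadratic forms, scalar measures and perturbations of observables -/

section Basic

variable {Ω : Type u} [MeasurableSpace Ω] {H : Type v} [NormedAddCommGroup H]
  [InnerProductSpace ℂ H]

/-- The quadratic form of an operator, truncated to a nonnegative extended real. -/
noncomputable def quad (T : H →L[ℂ] H) (φ : H) : ENNReal :=
  ENNReal.ofReal (inner ℂ φ (T φ)).re

lemma quad_ne_top (T : H →L[ℂ] H) (φ : H) : quad T φ ≠ ⊤ := ENNReal.ofReal_ne_top

lemma quad_zero (φ : H) : quad (0 : H →L[ℂ] H) φ = 0 := by simp [quad]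

lemma inner_eq_quad {T : H →L[ℂ] H} (hT : T.IsPositive) (φ : H) :
    inner ℂ φ (T φ) = ((quad T φ).toReal : ℂ) := by
  have h := hT.inner_nonneg_right φ
  rw [quad, ENNReal.toReal_ofReal (Complex.nonneg_iff.1 h).1]
  exact Complex.ext (by simp) (by simpa using (Complex.nonneg_iff.1 h).2.symm)

lemma ext_inner_right_self {T S : H →L[ℂ] H}
    (h : ∀ φ, inner ℂ φ (T φ) = inner ℂ φ (S φ)) : T = S := by
  apply ContinuousLinearMap.coe_injective
  refine (ext_inner_map _ _).1 fun φ => ?_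
  have := congrArg (starRingEnd ℂ) (h φ)
  rwa [inner_conj_symm, inner_conj_symm] at this

lemma eq_of_quad {T S : H →L[ℂ] H} (hT : T.IsPositive) (hS : S.IsPositive)
    (h : ∀ φ, quad T φ = quad S φ) : T = S :=
  ext_inner_right_self fun φ => by rw [inner_eq_quad hT, inner_eq_quad hS, h]

lemma quad_add {T S : H →L[ℂ] H} (hT : T.IsPositive) (hS : S.IsPositive) (φ : H) :
    quad (T + S) φ = quad T φ + quad S φ := by
  rw [quad, quad, quad, ← ENNReal.ofReal_add]
  · simp
  · exact hT.re_inner_nonneg_right φ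
  · exact hS.re_inner_nonneg_right φ

lemma quad_mono {T S : H →L[ℂ] H} (h : T ≤ S) (φ : H) : quad T φ ≤ quad S φ := by
  refine ENNReal.ofReal_le_ofReal ?_
  have := (ContinuousLinearMap.le_def _ _ |>.1 h).re_inner_nonneg_right φ
  simpa [inner_sub_right] using this

lemma inner_polarization (T : H →L[ℂ] H) (φ ψ : H) :
    inner ℂ φ (T ψ) = (inner ℂ (φ + ψ) (T (φ + ψ)) - inner ℂ (φ - ψ) (T (φ - ψ)) -
      Complex.I * inner ℂ (φ + Complex.I • ψ) (T (φ + Complex.I • ψ)) +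
      Complex.I * inner ℂ (φ - Complex.I • ψ) (T (φ - Complex.I • ψ))) / 4 := by
  simp only [map_add, map_sub, inner_add_left, inner_add_right, map_smul, inner_smul_left,
    inner_smul_right, Complex.conj_I, inner_sub_left, inner_sub_right]
  ring_nf
  simp only [Complex.I_sq]
  ring

lemma hasSum_inner_of_self {ι : Type*} {T : ι → H →L[ℂ] H} {S : H →L[ℂ] H}
    (h : ∀ φ, HasSum (fun i => inner ℂ φ (T i φ)) (inner ℂ φ (S φ))) (φ ψ : H) :
    HasSum (fun i => inner ℂ φ (T i ψ)) (inner ℂ φ (S ψ)) := by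
  simp only [inner_polarization _ φ ψ]
  exact ((((h _).sub (h _)).sub ((h _).mul_left _)).add ((h _).mul_left _)).div_const _

/-- Polarization reduces to `φ = ψ`, where all terms are nonnegative and the total is finite, so
summation in `ENNReal` loses nothing. -/
lemma hasSum_inner_of_quad {ι : Type*} {T : ι → H →L[ℂ] H} {S : H →L[ℂ] H}
    (hT : ∀ i, (T i).IsPositive) (hS : S.IsPositive)
    (h : ∀ φ, ∑' i, quad (T i) φ = quad S φ) (φ ψ : H) :
    HasSum (fun i => inner ℂ φ (T i ψ)) (inner ℂ φ (S ψ)) := by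
  refine hasSum_inner_of_self (fun φ => ?_) φ ψ
  simp only [inner_eq_quad hS, inner_eq_quad (hT _)]
  rw [Complex.hasSum_ofReal, ← h φ, ENNReal.tsum_toReal_eq fun i => quad_ne_top _ _]
  exact ENNReal.hasSum_toReal (by rw [h φ]; exact quad_ne_top _ _)

variable [CompleteSpace H]

/-- A constant sequence is summable over `ℕ` only if it is zero. -/
lemma IsObservable.empty {M : Set Ω → H →L[ℂ] H} (hM : IsObservable M) : M ∅ = 0 := by
  refine ext_inner_right_self fun φ => ?_
  have h := (hM.hasSum_iUnion (fun _ => ∅) (fun _ => .empty) (fun _ _ _ => by simp) φ φ).summable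
  simpa using (summable_const_iff _).1 h

/-- The scalar measure `X ↦ ⟪φ, M X φ⟫` of an observable. -/
noncomputable def IsObservable.toMeasure {M : Set Ω → H →L[ℂ] H} (hM : IsObservable M) (φ : H) :
    Measure Ω :=
  Measure.ofMeasurable (fun X _ => quad (M X) φ) (by rw [hM.empty, quad_zero]) fun X hX hd => by
    have h := hM.hasSum_iUnion X hX (fun i j hij => hd hij) φ φ
    rw [inner_eq_quad (hM.isPositive _ (.iUnion hX))] at h
    simp only [inner_eq_quad (hM.isPositive _ (hX _))] at h
    rw [Complex.hasSum_ofReal] at h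
    rw [← ENNReal.ofReal_toReal (quad_ne_top (M (⋃ i, X i)) φ), ← h.tsum_eq,
      ENNReal.ofReal_tsum_of_nonneg (fun _ => ENNReal.toReal_nonneg) h.summable]
    exact tsum_congr fun i => ENNReal.ofReal_toReal (quad_ne_top _ _)

lemma IsObservable.toMeasure_apply {M : Set Ω → H →L[ℂ] H} (hM : IsObservable M) (φ : H)
    {X : Set Ω} (hX : MeasurableSet X) : hM.toMeasure φ X = quad (M X) φ :=
  Measure.ofMeasurable_apply X hX

instance IsObservable.isFiniteMeasure_toMeasure {M : Set Ω → H →L[ℂ] H} (hM : IsObservable M)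
    (φ : H) : IsFiniteMeasure (hM.toMeasure φ) :=
  ⟨by rw [hM.toMeasure_apply φ .univ]; exact (quad_ne_top _ _).lt_top⟩

lemma IsObservable.eq_of_toMeasure {M : Set Ω → H →L[ℂ] H} (hM : IsObservable M) {X : Set Ω}
    (hX : MeasurableSet X) {T : H →L[ℂ] H} (hT : T.IsPositive)
    (h : ∀ φ, hM.toMeasure φ X = quad T φ) : M X = T :=
  eq_of_quad (hM.isPositive X hX) hT fun φ => by rw [← h φ, hM.toMeasure_apply φ hX]

lemma IsObservable.eq_zero_iff {M : Set Ω → H →L[ℂ] H} (hM : IsObservable M) {X : Set Ω}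
    (hX : MeasurableSet X) : M X = 0 ↔ ∀ φ, hM.toMeasure φ X = 0 := by
  refine ⟨fun h φ => ?_, fun h => hM.eq_of_toMeasure hX ContinuousLinearMap.isPositive_zero
    fun φ => by rw [h, quad_zero]⟩
  rw [hM.toMeasure_apply φ hX, h, quad_zero]

lemma IsObservable.of_quad {M : Set Ω → H →L[ℂ] H} (h0 : ∀ X, ¬ MeasurableSet X → M X = 0)
    (hpos : ∀ X, MeasurableSet X → (M X).IsPositive) (huniv : M Set.univ = 1)
    (hsum : ∀ X : ℕ → Set Ω, (∀ i, MeasurableSet (X i)) →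
      (∀ i j, i ≠ j → Disjoint (X i) (X j)) → ∀ φ,
      ∑' i, quad (M (X i)) φ = quad (M (⋃ i, X i)) φ) : IsObservable M where
  not_measurable := h0
  isPositive := hpos
  univ := huniv
  hasSum_iUnion X hX hd :=
    hasSum_inner_of_quad (fun i => hpos _ (hX i)) (hpos _ (.iUnion hX)) (hsum X hX hd)

lemma IsObservable.union {M : Set Ω → H →L[ℂ] H} (hM : IsObservable M) {X Y : Set Ω}
    (hX : MeasurableSet X) (hY : MeasurableSet Y) (hd : Disjoint X Y) :
    M (X ∪ Y) = M X + M Y :=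
  hM.eq_of_toMeasure (hX.union hY) ((hM.isPositive X hX).add (hM.isPositive Y hY)) fun φ => by
    rw [measure_union hd hY, quad_add (hM.isPositive X hX) (hM.isPositive Y hY),
      hM.toMeasure_apply φ hX, hM.toMeasure_apply φ hY]

lemma IsObservable.mono {M : Set Ω → H →L[ℂ] H} (hM : IsObservable M) {X Y : Set Ω}
    (hX : MeasurableSet X) (hY : MeasurableSet Y) (h : X ⊆ Y) : M X ≤ M Y := by
  rw [ContinuousLinearMap.le_def, ← Set.union_sdiff_cancel h,
    hM.union hX (hY.diff hX) Set.disjoint_sdiff_right, add_sub_cancel_left]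
  exact hM.isPositive _ (hY.diff hX)

lemma IsObservable.nonempty [Nontrivial H] {M : Set Ω → H →L[ℂ] H} (hM : IsObservable M) :
    Nonempty Ω := by
  by_contra h
  rw [not_nonempty_iff] at h
  have := hM.univ
  rw [Set.univ_eq_empty_iff.2 h, hM.empty] at this
  exact zero_ne_one this

/-- A perturbation `D` of an extreme observable `A` for which `A + D` and `A - D` are observables
vanishes. -/
lemma IsExtreme.eq_zero {A : Set Ω → H →L[ℂ] H} (hA : IsExtreme A) (D : Set Ω → H →L[ℂ] H)
    (hadd : ∀ X, MeasurableSet X → (A X + D X).IsPositive)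
    (hsub : ∀ X, MeasurableSet X → (A X - D X).IsPositive) (huniv : D Set.univ = 0)
    (hsum : ∀ X : ℕ → Set Ω, (∀ i, MeasurableSet (X i)) →
      (∀ i j, i ≠ j → Disjoint (X i) (X j)) → ∀ φ ψ : H,
      HasSum (fun i => inner ℂ φ (D (X i) ψ)) (inner ℂ φ (D (⋃ i, X i) ψ)))
    {X : Set Ω} (hX : MeasurableSet X) : D X = 0 := by
  classical
  have hobs : IsObservable A := hA.1
  let E : Set Ω → H →L[ℂ] H := fun X => if MeasurableSet X then D X else 0
  have hE : ∀ {X}, MeasurableSet X → E X = D X := fun h => if_pos h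
  have hE0 : ∀ {X}, ¬ MeasurableSet X → E X = 0 := fun h => if_neg h
  have h1 : IsObservable (A + E) :=
    { not_measurable := fun X hX => by simp [hobs.not_measurable X hX, hE0 hX]
      isPositive := fun X hX => by simpa [hE hX] using hadd X hX
      univ := by simp [hE .univ, huniv, hobs.univ]
      hasSum_iUnion := fun X hX hd φ ψ => by
        simpa [hE (hX _), hE (MeasurableSet.iUnion hX), inner_add_right] using
          (hobs.hasSum_iUnion X hX hd φ ψ).add (hsum X hX hd φ ψ) }
  have h2 : IsObservable (A - E) :=
    { not_measurable := fun X hX => by simp [hobs.not_measurable X hX, hE0 hX]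
      isPositive := fun X hX => by simpa [hE hX] using hsub X hX
      univ := by simp [hE .univ, huniv, hobs.univ]
      hasSum_iUnion := fun X hX hd φ ψ => by
        simpa [hE (hX _), hE (MeasurableSet.iUnion hX), inner_sub_right] using
          (hobs.hasSum_iUnion X hX hd φ ψ).sub (hsum X hX hd φ ψ) }
  -- `A` is the midpoint of `A + E` and `A - E`.
  have h := hA.2 h1 h2 ⟨1 / 2, 1 / 2, by norm_num, by norm_num, by norm_num, by
    rw [← smul_add, add_add_sub_cancel, ← two_smul ℝ A, smul_smul]; norm_num⟩
  have := congrFun (add_eq_left.1 h) X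
  rwa [hE hX] at this

end Basic

lemma hasSum_indicator_iUnion {α : Type*} {Y : ℕ → Set α} (hd : ∀ i j, i ≠ j → Disjoint (Y i) (Y j)) (z : α) :
    HasSum (fun k => (Y k).indicator (1 : α → ℂ) z) ((⋃ k, Y k).indicator (1 : α → ℂ) z) := by
  by_cases hz : z ∈ ⋃ k, Y k
  · obtain ⟨k, hk⟩ := Set.mem_iUnion.1 hz
    rw [Set.indicator_of_mem hz, ← Set.indicator_of_mem hk (1 : α → ℂ)]
    exact hasSum_single k fun j hj =>
      Set.indicator_of_notMem (fun hzj => Set.disjoint_left.1 (hd j k hj) hzj hk) _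
  · rw [Set.indicator_of_notMem hz]
    have : (fun k => (Y k).indicator (1 : α → ℂ) z) = fun _ => 0 := funext fun k =>
      Set.indicator_of_notMem (fun h => hz (Set.mem_iUnion_of_mem k h)) _
    rw [this]
    exact hasSum_zero

/-! ### Atoms of a discrete extreme observable -/

section Discrete

variable {Ω : Type u} [MeasurableSpace Ω] {H : Type v} [NormedAddCommGroup H]
  [InnerProductSpace ℂ H] {A : Set Ω → H →L[ℂ] H}

/-- `A` is concentrated on the points `x i`, and `X i` is a measurable set that contains `x i` and
no other of these points. -/
structure IsAtomFamily (A : Set Ω → H →L[ℂ] H) {I : Type*} (x : I → Ω) (X : I → Set Ω) :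
    Prop where
  measurableSet : ∀ i, MeasurableSet (X i)
  mem_iff : ∀ i j, x j ∈ X i ↔ j = i
  eq_zero : ∀ Y, MeasurableSet Y → (∀ i, x i ∉ Y) → A Y = 0

/-- The σ-algebra need not separate the points of `Ξ`, so points lying in the same measurable sets
are identified. Since there are only countably many classes, pairwise separating sets can be
intersected to isolate each one. -/
lemma IsDiscrete.exists_isAtomFamily (hA : IsDiscrete A) :
    ∃ (I : Type u) (_ : Countable I) (x : I → Ω) (X : I → Set Ω), IsAtomFamily A x X := by
  classical
  obtain ⟨Ξ, hΞ, hac⟩ := hA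
  have := hΞ.to_subtype
  let r : Setoid Ξ :=
    { r := fun a b => ∀ Y : Set Ω, MeasurableSet Y → ((a : Ω) ∈ Y ↔ (b : Ω) ∈ Y)
      iseqv := ⟨fun _ _ _ => Iff.rfl, fun h Y hY => (h Y hY).symm,
        fun h h' Y hY => (h Y hY).trans (h' Y hY)⟩ }
  let x : Quotient r → Ω := fun i => (i.out : Ω)
  have hsep : ∀ i j : Quotient r, ∃ S : Set Ω, MeasurableSet S ∧ x i ∈ S ∧ (x j ∈ S → j = i) := by
    intro i j
    by_cases hij : j = i
    · exact ⟨Set.univ, .univ, trivial, fun _ => hij⟩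
    · have : ¬ ∀ Y : Set Ω, MeasurableSet Y → (x j ∈ Y ↔ x i ∈ Y) := fun h =>
        hij (by rw [← Quotient.out_eq j, ← Quotient.out_eq i]; exact Quotient.sound h)
      push Not at this
      obtain ⟨Y, hY, ⟨h1, h2⟩ | ⟨h1, h2⟩⟩ := this
      · exact ⟨Yᶜ, hY.compl, h2, fun h => absurd h1 h⟩
      · exact ⟨Y, hY, h2, fun h => absurd h h1⟩
  choose S hS hiS hjS using hsep
  refine ⟨Quotient r, inferInstance, x, fun i => ⋂ j, S i j, fun i => .iInter fun j => hS i j,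
    fun i j => ⟨fun h => hjS i j (Set.mem_iInter.1 h j), ?_⟩, fun Y hY h => hac Y hY ?_⟩
  · rintro rfl
    exact Set.mem_iInter.2 fun k => hiS j k
  · rw [Measure.sum_apply _ hY, ENNReal.tsum_eq_zero]
    intro a
    rw [Measure.dirac_apply' _ hY]
    refine Set.indicator_of_notMem (fun ha => h ⟦a⟧ ?_) _
    exact (Quotient.exact (Quotient.out_eq (⟦a⟧ : Quotient r)) Y hY).2 ha

variable [CompleteSpace H] {I : Type*} {x : I → Ω} {X : I → Set Ω}

/-- `Y \ Y'` contains none of the points `x i`, hence carries no mass. -/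
lemma IsAtomFamily.le_of_preimage_subset (h : IsAtomFamily A x X) (hA : IsObservable A)
    {Y Y' : Set Ω} (hY : MeasurableSet Y) (hY' : MeasurableSet Y') (hs : x ⁻¹' Y ⊆ x ⁻¹' Y') :
    A Y ≤ A Y' := by
  have h0 : A (Y \ Y') = 0 := h.eq_zero _ (hY.diff hY') fun i hi => hi.2 (hs hi.1)
  rw [← Set.inter_union_sdiff Y Y', hA.union (hY.inter hY') (hY.diff hY')
    (Set.disjoint_sdiff_right.mono_left Set.inter_subset_right), h0, add_zero]
  exact hA.mono (hY.inter hY') hY' Set.inter_subset_right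

lemma IsAtomFamily.apply_le (h : IsAtomFamily A x X) (hA : IsObservable A) {Y : Set Ω}
    (hY : MeasurableSet Y) {i : I} (hi : x i ∈ Y) : A (X i) ≤ A Y :=
  h.le_of_preimage_subset hA (h.measurableSet i) hY fun j hj => by
    rw [Set.mem_preimage, h.mem_iff] at hj
    rwa [Set.mem_preimage, hj]

/-- Different atoms of an extreme observable have no common nonzero positive lower bound. -/
lemma IsAtomFamily.eq_zero_of_le (h : IsAtomFamily A x X) (hA : IsExtreme A) {i j : I}
    (hij : i ≠ j) {E : H →L[ℂ] H} (hE : 0 ≤ E) (hi : E ≤ A (X i)) (hj : E ≤ A (X j)) :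
    E = 0 := by
  have hobs : IsObservable A := hA.1
  -- Adds mass `E` at `x i` and removes it at `x j`. Positivity survives because a set containing
  -- either point has value at least `E`.
  let D : Set Ω → H →L[ℂ] H := fun Y =>
    (Y.indicator (1 : Ω → ℂ) (x i) - Y.indicator (1 : Ω → ℂ) (x j)) • E
  have hAE : ∀ {Y}, MeasurableSet Y → x i ∈ Y ∨ x j ∈ Y → E ≤ A Y := fun hY hm =>
    hm.elim (fun hm => hi.trans (h.apply_le hobs hY hm)) fun hm => hj.trans (h.apply_le hobs hY hm)
  have hA0 : ∀ {Y}, MeasurableSet Y → 0 ≤ A Y := fun hY => by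
    rw [ContinuousLinearMap.nonneg_iff_isPositive]; exact hobs.isPositive _ hY
  have hD : D (X i) = 0 := by
    refine hA.eq_zero D (fun Y hY => ?_) (fun Y hY => ?_) (by simp [D]) (fun Y hY hd φ ψ => ?_)
      (h.measurableSet i)
    · rw [← ContinuousLinearMap.nonneg_iff_isPositive]
      by_cases h1 : x i ∈ Y <;> by_cases h2 : x j ∈ Y <;> simp only [D, h1, h2,
        Set.indicator_of_mem, Set.indicator_of_notMem, not_false_eq_true, Pi.one_apply, sub_self,
        zero_smul, add_zero, sub_zero, one_smul, zero_sub, neg_smul, ← sub_eq_add_neg, sub_nonneg,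
        hA0 hY]
      · exact add_nonneg (hA0 hY) hE
      · exact hAE hY (.inr h2)
    · rw [← ContinuousLinearMap.nonneg_iff_isPositive]
      by_cases h1 : x i ∈ Y <;> by_cases h2 : x j ∈ Y <;> simp only [D, h1, h2,
        Set.indicator_of_mem, Set.indicator_of_notMem, not_false_eq_true, Pi.one_apply, sub_self,
        zero_smul, sub_zero, one_smul, zero_sub, neg_smul, sub_neg_eq_add, sub_nonneg,
        hA0 hY]
      · exact hAE hY (.inl h1)
      · exact add_nonneg (hA0 hY) hE
    · simpa [D, inner_smul_right] using
        ((hasSum_indicator_iUnion hd (x i)).sub (hasSum_indicator_iUnion hd (x j))).mul_right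
          (inner ℂ φ (E ψ))
  have hi' : x i ∈ X i := (h.mem_iff i i).2 rfl
  have hj' : x j ∉ X i := fun hm => hij ((h.mem_iff i j).1 hm).symm
  simpa [D, hi', hj'] using hD

variable {Θ : Type*} [MeasurableSpace Θ] {M : Set Θ → H →L[ℂ] H}

/-- A discrete extreme observable whose atoms lie in the range of an observable `M` is the image of
`M` under a measurable map with countably many values. -/
lemma IsAtomFamily.exists_index [Countable I] [Nonempty I] (h : IsAtomFamily A x X)
    (hA : IsExtreme A) (hM : IsObservable M) {Z : I → Set Θ} (hZ : ∀ i, MeasurableSet (Z i))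
    (hMZ : ∀ i, M (Z i) = A (X i)) :
    ∃ f : Θ → I, (∀ s, MeasurableSet (f ⁻¹' s)) ∧
      ∀ Y, MeasurableSet Y → M (f ⁻¹' (x ⁻¹' Y)) = A Y := by
  have hobs : IsObservable A := hA.1
  let P : I → Set Θ := fun i => Z i \ ⋃ j, ⋃ _ : j ≠ i, Z j
  have hP : ∀ i, MeasurableSet (P i) := fun i =>
    (hZ i).diff (.iUnion fun j => .iUnion fun _ => hZ j)
  have hPd : Pairwise (Function.onFun Disjoint P) := fun i j hij =>
    Set.disjoint_left.2 fun θ hi hj => hj.2 (Set.mem_iUnion₂.2 ⟨i, hij, hi.1⟩)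
  have hMP : ∀ i φ, hM.toMeasure φ (P i) = hobs.toMeasure φ (X i) := fun i φ => by
    rw [hobs.toMeasure_apply φ (h.measurableSet i), ← hMZ i, ← hM.toMeasure_apply φ (hZ i)]
    refine measure_sdiff_null' ?_
    simp only [Set.inter_iUnion]
    refine (measure_iUnion_null_iff).2 fun j => measure_iUnion_null_iff.2 fun hj => ?_
    refine (hM.eq_zero_iff ((hZ i).inter (hZ j))).1 ?_ φ
    refine h.eq_zero_of_le hA hj.symm ?_ ?_ ?_
    · rw [ContinuousLinearMap.nonneg_iff_isPositive]
      exact hM.isPositive _ ((hZ i).inter (hZ j))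
    · rw [← hMZ]; exact hM.mono ((hZ i).inter (hZ j)) (hZ i) Set.inter_subset_left
    · rw [← hMZ]; exact hM.mono ((hZ i).inter (hZ j)) (hZ j) Set.inter_subset_right
  let _ : MeasurableSpace I := ⊤
  -- Points outside all `P i` receive an arbitrary index; the mass comparison below shows that this
  -- does not matter.
  obtain ⟨f, hf, hfP⟩ := exists_measurable_piecewise P hP (fun i (_ : Θ) => i)
    (fun i => measurable_const) (fun i j hij θ hθ =>
      (Set.disjoint_left.1 (hPd hij) hθ.1 hθ.2).elim)
  have hfm : ∀ s, MeasurableSet (f ⁻¹' s) := fun s => hf trivial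
  have hle : ∀ φ Y, MeasurableSet Y →
      hobs.toMeasure φ Y ≤ hM.toMeasure φ (f ⁻¹' (x ⁻¹' Y)) := fun φ Y hY => by
    have hU : MeasurableSet (⋃ i : x ⁻¹' Y, X i) := .iUnion fun i => h.measurableSet i
    calc hobs.toMeasure φ Y ≤ hobs.toMeasure φ (⋃ i : x ⁻¹' Y, X i) := by
          rw [hobs.toMeasure_apply φ hY, hobs.toMeasure_apply φ hU]
          exact quad_mono (h.le_of_preimage_subset hobs hY hU fun i hi =>
            Set.mem_iUnion.2 ⟨⟨i, hi⟩, (h.mem_iff i i).2 rfl⟩) φ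
      _ ≤ ∑' i : x ⁻¹' Y, hobs.toMeasure φ (X i) := measure_iUnion_le _
      _ = ∑' i : x ⁻¹' Y, hM.toMeasure φ (P i) := by simp only [hMP]
      _ = hM.toMeasure φ (⋃ i : x ⁻¹' Y, P i) := (measure_iUnion
          (f := fun i : x ⁻¹' Y => P i)
          (fun i j hij => hPd (Subtype.coe_injective.ne hij)) fun i => hP i).symm
      _ ≤ hM.toMeasure φ (f ⁻¹' (x ⁻¹' Y)) := measure_mono <| Set.iUnion_subset fun i θ hθ => by
          rw [Set.mem_preimage, hfP i hθ]
          exact i.2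
  refine ⟨f, hfm, fun Y hY => hM.eq_of_toMeasure (hfm _) (hobs.isPositive Y hY) fun φ => ?_⟩
  rw [← hobs.toMeasure_apply φ hY]
  -- The bound `hle` also holds for `Yᶜ`, and the total masses agree, so neither inequality can be
  -- strict.
  refine le_antisymm ?_ (hle φ Y hY)
  have h1 := measure_add_measure_compl (μ := hM.toMeasure φ) (hfm (x ⁻¹' Y))
  rw [hM.toMeasure_apply φ .univ, hM.univ, ← hobs.univ, ← hobs.toMeasure_apply φ .univ,
    ← measure_add_measure_compl hY] at h1
  refine (ENNReal.add_le_add_iff_right (measure_ne_top (hobs.toMeasure φ) Yᶜ)).1 ?_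
  rw [← h1]
  gcongr
  exact hle φ Yᶜ hY.compl

end Discrete

/-! ### Localization of `B` to the fibres and the joint observable -/

section Joint

variable {Ω : Type u} [MeasurableSpace Ω] {H : Type v} [NormedAddCommGroup H]
  [InnerProductSpace ℂ H] [CompleteSpace H] {A : Set Ω → H →L[ℂ] H}
  {Θ : Type*} [MeasurableSpace Θ] {M : Set Θ → H →L[ℂ] H}

lemma IsObservable.hasSum_preimage_inter (hM : IsObservable M) {g : Θ → Ω} (hg : Measurable g)
    {W : Set Θ} (hW : MeasurableSet W) {Y : ℕ → Set Ω} (hY : ∀ i, MeasurableSet (Y i))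
    (hd : ∀ i j, i ≠ j → Disjoint (Y i) (Y j)) (φ ψ : H) :
    HasSum (fun i => inner ℂ φ (M (g ⁻¹' Y i ∩ W) ψ)) (inner ℂ φ (M (g ⁻¹' (⋃ i, Y i) ∩ W) ψ)) := by
  rw [Set.preimage_iUnion, Set.iUnion_inter]
  exact hM.hasSum_iUnion _ (fun i => (hg (hY i)).inter hW) (fun i j hij =>
    ((hd i j hij).preimage g).mono Set.inter_subset_left Set.inter_subset_left) φ ψ

/-- If an extreme observable is an image of `M` under `g`, then an additive relation between values
of `M` localizes to the sets `g ⁻¹' Y`. -/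
lemma IsExtreme.preimage_inter_add (hA : IsExtreme A) (hM : IsObservable M) {g : Θ → Ω}
    (hg : Measurable g) (hgA : ∀ Y, MeasurableSet Y → M (g ⁻¹' Y) = A Y) {W₁ W₂ W : Set Θ}
    (h₁ : MeasurableSet W₁) (h₂ : MeasurableSet W₂) (h : MeasurableSet W)
    (hadd : M W = M W₁ + M W₂) {Y : Set Ω} (hY : MeasurableSet Y) :
    M (g ⁻¹' Y ∩ W) = M (g ⁻¹' Y ∩ W₁) + M (g ⁻¹' Y ∩ W₂) := by
  open ComplexOrder in
  have hhalf : (0 : ℂ) ≤ 1 / 2 := by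
    rw [Complex.nonneg_iff]; norm_num
  -- The two summands together may reach `2 • A Y`; the factor `1 / 2` keeps `A - D` positive. The
  -- relation `hadd` enters only as `D Set.univ = 0`.
  let D : Set Ω → H →L[ℂ] H := fun Y =>
    (1 / 2 : ℂ) • (M (g ⁻¹' Y ∩ W₁) + M (g ⁻¹' Y ∩ W₂) - M (g ⁻¹' Y ∩ W))
  have hpos : ∀ {Y V}, MeasurableSet Y → MeasurableSet V → (M (g ⁻¹' Y ∩ V)).IsPositive :=
    fun hY hV => hM.isPositive _ ((hg hY).inter hV)
  have hle : ∀ {Y V}, MeasurableSet Y → MeasurableSet V →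
      (A Y - M (g ⁻¹' Y ∩ V)).IsPositive := fun {Y V} hY hV => by
    rw [← ContinuousLinearMap.le_def, ← hgA Y hY]
    exact hM.mono ((hg hY).inter hV) (hg hY) Set.inter_subset_left
  have hD : D Y = 0 := by
    refine hA.eq_zero D (fun Y hY => ?_) (fun Y hY => ?_) ?_ (fun Y hY hd φ ψ => ?_) hY
    · have : A Y + D Y = (1 / 2 : ℂ) • (A Y + (A Y - M (g ⁻¹' Y ∩ W)) +
          (M (g ⁻¹' Y ∩ W₁) + M (g ⁻¹' Y ∩ W₂))) := by
        simp only [D]; module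
      rw [this]
      exact (((hA.1.isPositive Y hY).add (hle hY h)).add
        ((hpos hY h₁).add (hpos hY h₂))).smul_of_nonneg hhalf
    · have : A Y - D Y = (1 / 2 : ℂ) • ((A Y - M (g ⁻¹' Y ∩ W₁)) +
          (A Y - M (g ⁻¹' Y ∩ W₂)) + M (g ⁻¹' Y ∩ W)) := by
        simp only [D]; module
      rw [this]
      exact (((hle hY h₁).add (hle hY h₂)).add (hpos hY h)).smul_of_nonneg hhalf
    · simp [D, hadd]
    · have := ((hM.hasSum_preimage_inter hg h₁ hY hd φ ψ).add
        (hM.hasSum_preimage_inter hg h₂ hY hd φ ψ)).sub (hM.hasSum_preimage_inter hg h hY hd φ ψ)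
      simpa [D, inner_smul_right, inner_add_right, inner_sub_right] using this.mul_left (1 / 2 : ℂ)
  have := (smul_eq_zero.1 hD).resolve_left (by norm_num)
  exact (sub_eq_zero.1 this).symm

/-- A finitely additive operator valued set function that is dominated by an observable is
σ-additive. -/
lemma IsObservable.tsum_quad_of_le {B C : Set Ω → H →L[ℂ] H} (hB : IsObservable B)
    (hC : ∀ Y, MeasurableSet Y → (C Y).IsPositive) (hCB : ∀ Y, MeasurableSet Y → C Y ≤ B Y)
    (hadd : ∀ Y Y', MeasurableSet Y → MeasurableSet Y' → Disjoint Y Y' →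
      C (Y ∪ Y') = C Y + C Y')
    {Y : ℕ → Set Ω} (hY : ∀ i, MeasurableSet (Y i)) (hd : ∀ i j, i ≠ j → Disjoint (Y i) (Y j))
    (φ : H) : ∑' i, quad (C (Y i)) φ = quad (C (⋃ i, Y i)) φ := by
  have hm : ∀ n, MeasurableSet (⋃ k, Y (k + n)) := fun n => .iUnion fun k => hY _
  have hsplit : ∀ n, quad (C (⋃ i, Y i)) φ =
      ∑ i ∈ Finset.range n, quad (C (Y i)) φ + quad (C (⋃ k, Y (k + n))) φ := fun n => by
    induction n with
    | zero => simp
    | succ n ih =>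
      have hU : ⋃ k, Y (k + n) = Y n ∪ ⋃ k, Y (k + (n + 1)) := by
        rw [← Set.union_iUnion_nat_succ fun k => Y (k + n)]
        simp only [zero_add, add_right_comm, add_assoc]
      have hdisj : Disjoint (Y n) (⋃ k, Y (k + (n + 1))) :=
        Set.disjoint_iUnion_right.2 fun k => hd _ _ (by omega)
      rw [ih, hU, hadd _ _ (hY n) (hm _) hdisj, quad_add (hC _ (hY n)) (hC _ (hm _)),
        Finset.sum_range_succ, add_assoc]
  refine le_antisymm ?_ ?_
  · rw [ENNReal.tsum_eq_iSup_nat]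
    exact iSup_le fun n => (hsplit n).symm ▸ le_self_add
  · have hB' : ∀ n, hB.toMeasure φ (⋃ k, Y (k + n)) = ∑' k, hB.toMeasure φ (Y (k + n)) :=
      fun n => measure_iUnion (fun i j hij => hd _ _ (by omega)) fun k => hY _
    have hlim := ENNReal.tendsto_sum_nat_add (fun k => hB.toMeasure φ (Y k))
      (by rw [← measure_iUnion (fun i j hij => hd i j hij) hY]; exact measure_ne_top _ _)
    have hlim' := (tendsto_const_nhds (x := ∑' i, quad (C (Y i)) φ)).add hlim
    rw [add_zero] at hlim'
    -- The tail of `C` is at most the tail of the finite measure given by `B`, which tends to zero.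
    refine ge_of_tendsto' hlim' fun n => ?_
    rw [hsplit n, ← hB' n, hB.toMeasure_apply φ (hm n)]
    exact add_le_add (ENNReal.sum_le_tsum _) (quad_mono (hCB _ (hm n)) φ)

variable {Ω' : Type w} [MeasurableSpace Ω'] {B : Set Ω' → H →L[ℂ] H}

/-- Normalizing `W` at `∅` and `Set.univ` makes the first marginal of the joint observable exact;
the two choices are compatible because `Ω'` is nonempty. -/
lemma exists_preimage_range (hM : IsObservable M) (hB : IsObservable B) [Nonempty Ω']
    (h : ran B ⊆ ran M) : ∃ W : Set Ω' → Set Θ, (∀ Y, MeasurableSet Y → MeasurableSet (W Y)) ∧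
      (∀ Y, MeasurableSet Y → M (W Y) = B Y) ∧ W ∅ = ∅ ∧ W Set.univ = Set.univ := by
  classical
  have : ∀ Y : Set Ω', ∃ Z : Set Θ, MeasurableSet Y → MeasurableSet Z ∧ M Z = B Y := fun Y => by
    by_cases hY : MeasurableSet Y
    · obtain ⟨Z, hZ⟩ := h ⟨Y, hY, rfl⟩
      exact ⟨Z, fun _ => hZ⟩
    · exact ⟨∅, fun h => absurd h hY⟩
  choose W hW using this
  refine ⟨fun Y => if Y = ∅ then ∅ else if Y = Set.univ then Set.univ else W Y,
    fun Y hY => ?_, fun Y hY => ?_, if_pos rfl, ?_⟩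
  · dsimp only
    split_ifs
    exacts [.empty, .univ, (hW Y hY).1]
  · dsimp only
    split_ifs with h1 h2
    exacts [by rw [h1, hM.empty, hB.empty], by rw [h2, hM.univ, hB.univ], (hW Y hY).2]
  · simp [Set.univ_nonempty.ne_empty]

/-- The joint observable: `x` enumerates the points of concentration of `A`, `f` selects one of them
for each outcome of `M`, and `W` represents the values of `B` as values of `M`. -/
lemma jointlyMeasurable_of_index {I : Type*} [Countable I] {x : I → Ω} {X : I → Set Ω}
    (h : IsAtomFamily A x X) (hA : IsExtreme A) (hB : IsObservable B) (hM : IsObservable M)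
    {f : Θ → I} (hf : ∀ s, MeasurableSet (f ⁻¹' s))
    (hfA : ∀ Y, MeasurableSet Y → M (f ⁻¹' (x ⁻¹' Y)) = A Y) {W : Set Ω' → Set Θ}
    (hW : ∀ Y, MeasurableSet Y → MeasurableSet (W Y)) (hMW : ∀ Y, MeasurableSet Y → M (W Y) = B Y)
    (hW0 : W ∅ = ∅) (hW1 : W Set.univ = Set.univ) : JointlyMeasurable A B := by
  classical
  -- Where `f` takes the value `i`, the outcome in `Ω` is `x i`, so only the section of `Q` at `x i`
  -- matters.
  let S : Set (Ω × Ω') → Set Θ := fun Q => ⋃ i, f ⁻¹' {i} ∩ W (Prod.mk (x i) ⁻¹' Q)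
  have hmem : ∀ Q θ, θ ∈ S Q ↔ θ ∈ W (Prod.mk (x (f θ)) ⁻¹' Q) := fun Q θ => by simp [S]
  have hsec : ∀ {Q : Set (Ω × Ω')} i, MeasurableSet Q → MeasurableSet (Prod.mk (x i) ⁻¹' Q) :=
    fun i hQ => measurable_prodMk_left hQ
  have hS' : ∀ {Q} i, MeasurableSet Q → MeasurableSet (f ⁻¹' {i} ∩ W (Prod.mk (x i) ⁻¹' Q)) :=
    fun i hQ => (hf {i}).inter (hW _ (hsec i hQ))
  have hS : ∀ {Q}, MeasurableSet Q → MeasurableSet (S Q) := fun hQ => .iUnion fun i => hS' i hQ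
  let N : Set (Ω × Ω') → H →L[ℂ] H := fun Q => if MeasurableSet Q then M (S Q) else 0
  have hN : ∀ {Q}, MeasurableSet Q → N Q = M (S Q) := fun hQ => if_pos hQ
  have hquad : ∀ {Q}, MeasurableSet Q → ∀ φ,
      quad (N Q) φ = ∑' i, quad (M (f ⁻¹' {i} ∩ W (Prod.mk (x i) ⁻¹' Q))) φ := fun {Q} hQ φ => by
    rw [hN hQ, ← hM.toMeasure_apply φ (hS hQ), measure_iUnion _ fun i => hS' i hQ]
    · exact tsum_congr fun i => hM.toMeasure_apply φ (hS' i hQ)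
    · exact fun i j hij => ((Set.disjoint_singleton.2 hij).preimage f).mono
        Set.inter_subset_left Set.inter_subset_left
  have hadd : ∀ i Y Y', MeasurableSet Y → MeasurableSet Y' → Disjoint Y Y' →
      M (f ⁻¹' {i} ∩ W (Y ∪ Y')) = M (f ⁻¹' {i} ∩ W Y) + M (f ⁻¹' {i} ∩ W Y') := by
    intro i Y Y' hY hY' hd
    have hXi : x ⁻¹' X i = {i} := Set.ext fun j => h.mem_iff i j
    have := hA.preimage_inter_add hM (g := x ∘ f) (fun s _ => hf (x ⁻¹' s)) hfA (hW Y hY)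
      (hW Y' hY') (hW _ (hY.union hY'))
      (by rw [hMW _ hY, hMW _ hY', hMW _ (hY.union hY'), hB.union hY hY' hd])
      (h.measurableSet i)
    rwa [Set.preimage_comp, hXi] at this
  have hprod1 : ∀ X : Set Ω, S (X ×ˢ Set.univ) = f ⁻¹' (x ⁻¹' X) := fun X => Set.ext fun θ => by
    rw [hmem]
    by_cases hθ : x (f θ) ∈ X
    · simp [Set.mk_preimage_prod_right hθ, hW1, hθ]
    · simp [Set.mk_preimage_prod_right_eq_empty hθ, hW0, hθ]
  have hprod2 : ∀ Y : Set Ω', S (Set.univ ×ˢ Y) = W Y := fun Y => Set.ext fun θ => by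
    rw [hmem, Set.mk_preimage_prod_right (Set.mem_univ _)]
  refine ⟨N, .of_quad (fun Q hQ => if_neg hQ) (fun Q hQ => ?_) ?_ (fun Q hQ hd φ => ?_),
    fun X hX => ?_, fun Y hY => ?_⟩
  · rw [hN hQ]
    exact hM.isPositive _ (hS hQ)
  · rw [hN .univ, ← Set.univ_prod_univ, hprod2, hMW _ .univ, hB.univ]
  · rw [hquad (.iUnion hQ)]
    simp only [hquad (hQ _), Set.preimage_iUnion]
    -- With the sums exchanged, σ-additivity is a statement about each single fibre.
    rw [ENNReal.tsum_comm]
    refine tsum_congr fun i => ?_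
    exact hB.tsum_quad_of_le (C := fun Y => M (f ⁻¹' {i} ∩ W Y))
      (fun Y hY => hM.isPositive _ ((hf {i}).inter (hW Y hY)))
      (fun Y hY => by
        rw [← hMW Y hY]
        exact hM.mono ((hf {i}).inter (hW Y hY)) (hW Y hY) Set.inter_subset_right)
      (hadd i) (fun k => hsec i (hQ k)) (fun j k hjk => (hd j k hjk).preimage _) φ
  · rw [hN (hX.prod .univ), hprod1, hfA X hX]
  · rw [hN (MeasurableSet.univ.prod hY), hprod2, hMW Y hY]

lemma Coexistent.jointlyMeasurable [Nontrivial H] (hdisc : IsDiscrete A) (hA : IsExtreme A)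
    (hB : IsObservable B) (h : Coexistent.{u, v, w, x} A B) : JointlyMeasurable A B := by
  obtain ⟨Θ, _, M, hM, hran⟩ := h
  obtain ⟨I, _, x, X, hX⟩ := hdisc.exists_isAtomFamily
  have : Nonempty Ω' := hB.nonempty
  have : Nonempty I := by
    by_contra hI
    rw [not_nonempty_iff] at hI
    have h0 := hX.eq_zero Set.univ .univ fun i => isEmptyElim i
    rw [hA.1.univ] at h0
    exact one_ne_zero h0
  choose Z hZ hMZ using fun i => hran (.inl ⟨X i, hX.measurableSet i, rfl⟩)
  obtain ⟨f, hf, hfA⟩ := hX.exists_index hA hM hZ hMZ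
  obtain ⟨W, hW, hMW, hW0, hW1⟩ :=
    exists_preimage_range hM hB (Set.subset_union_right.trans hran)
  exact jointlyMeasurable_of_index hX hA hB hM hf hfA hW hMW hW0 hW1

/-- The joint observable is itself the witness, transported along `ULift` only to reach the required
universe. -/
lemma JointlyMeasurable.coexistent (h : JointlyMeasurable A B) :
    Coexistent.{u, v, w, max u w x} A B := by
  obtain ⟨N, hN, hA, hB⟩ := h
  let e : ULift.{x} (Ω × Ω') ≃ᵐ Ω × Ω' := MeasurableEquiv.ulift
  have he : ∀ Z, MeasurableSet (e.symm ⁻¹' Z) ↔ MeasurableSet Z := fun Z =>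
    e.symm.measurableSet_preimage
  have hee : ∀ Q, e.symm ⁻¹' (e ⁻¹' Q) = Q := fun Q => by
    rw [← Set.preimage_comp]; simp
  refine ⟨ULift.{x} (Ω × Ω'), inferInstance, fun Z => N (e.symm ⁻¹' Z),
    ⟨fun Z hZ => hN.not_measurable _ fun h => hZ ((he Z).1 h),
      fun Z hZ => hN.isPositive _ ((he Z).2 hZ), hN.univ, fun Z hZ hd φ ψ => ?_⟩, ?_⟩
  · simp only [Set.preimage_iUnion]
    exact hN.hasSum_iUnion _ (fun i => (he _).2 (hZ i)) (fun i j hij => (hd i j hij).preimage _) φ ψ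
  · rintro T (⟨X, hX, rfl⟩ | ⟨Y, hY, rfl⟩)
    · exact ⟨e ⁻¹' (X ×ˢ Set.univ), e.measurable (hX.prod .univ), by
        dsimp only; rw [hee, hA X hX]⟩
    · exact ⟨e ⁻¹' (Set.univ ×ˢ Y), e.measurable (MeasurableSet.univ.prod hY), by
        dsimp only; rw [hee, hB Y hY]⟩

end Joint

end QuantumObservable

theorem corollary5p2p2014 {Ω : Type u} [MeasurableSpace Ω]
    {Ω' : Type w} [MeasurableSpace Ω'] {H : Type v} [NormedAddCommGroup H]
    [InnerProductSpace ℂ H] [CompleteSpace H] [TopologicalSpace.SeparableSpace H] [Nontrivial H]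
    (A : Set Ω → H →L[ℂ] H) (hA : QuantumObservable.IsObservable A)
    (hA_discrete : QuantumObservable.IsDiscrete A)
    (hA_extreme : QuantumObservable.IsExtreme A)
    (B : Set Ω' → H →L[ℂ] H) (hB : QuantumObservable.IsObservable B) :
    QuantumObservable.Coexistent.{u, v, w, max u w x} A B ↔
      QuantumObservable.JointlyMeasurable A B :=
  ⟨fun h => h.jointlyMeasurable hA_discrete hA_extreme hB, fun h => h.coexistent⟩
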